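/- Let $X, X_1, X_2, \dots$ be i.i.d. real random variables with common law $P$, and let $F:\mathbb{R}\to[0,\infty)$ and $U:\mathbb{R}\to\mathbb{R}$ be measurable functions such that $F(X)$ and $U(X)$ have finite means $\mu := E[F(X)]$, $\nu := E[U(X)]$ and finite second moments. Assume that $F(X)$ is heavy-tailed, in that $E[e^{\theta F(X)}]=\infty$ for all $\theta>0$, and that $U$ dominates $F$, in that $m(\beta) := \operatorname{ess\,sup}[F(X)-\beta U(X)]<\infty$ for all $\beta>0$. Write $S_n := \sum_{i=1}^n F(X_i)$ and $T_n := \sum_{i=1}^n U(X_i)$. For probability measures $Q$ on $\mathbb{R}$ let $H(Q\|P) := \int \log\frac{dQ}{dP}\,dQ$ if $Q\ll P$ and $H(Q\|P) := \infty$ otherwise. Logarithms, limits and infima are taken in $[-\infty,\infty]$, with $\log 0=-\infty$ and $\inf\emptyset=+\infty$, and integrals with respect to $Q$ are taken in the extended sense. Then: (i) For all $\varepsilon>0$, $$\lim_{n\to\infty}\frac1n\log \Pr\{S_n-n\mu>n\varepsilon\} = -\inf_{Q\in\Sigma}H(Q\|P)=0,$$ where $\Sigma$ is the set of all probability measures $Q$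 on $\mathbb{R}$ such that $\int F\,dQ-\mu>\varepsilon$. (ii) For all $\varepsilon,u>0$, $$\lim_{n\to\infty}\frac1n\log \Pr\{S_n-n\mu>n\varepsilon \text{ and } T_n-n\nu<nu\} = -\inf_{Q\in E}H(Q\|P)<0,$$ where $E\subset\Sigma$ is the set of all probability measures $Q$ on $\mathbb{R}$ such that $\int F\,dQ-\mu>\varepsilon$ and $\int U\,dQ-\nu<u$. (The value $-\infty$ is possible in (ii).) -/

import Mathlib

open MeasureTheory ProbabilityTheory Filter Topology
open scoped ENNReal

namespace ScreenedEstimation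

/-- The integral of `f` with respect to `Q` exists in the extended sense: the positive and the
negative part do not both have infinite integral. -/
def HasExtIntegral (f : ℝ → ℝ) (Q : Measure ℝ) : Prop :=
  (∫⁻ x, ENNReal.ofReal (f x) ∂Q) ≠ ⊤ ∨ (∫⁻ x, ENNReal.ofReal (-f x) ∂Q) ≠ ⊤

/-- The extended-real integral `∫ f⁺ dQ - ∫ f⁻ dQ ∈ [-∞, ∞]`; meaningful when
`HasExtIntegral f Q` holds. -/
noncomputable def extIntegral (f : ℝ → ℝ) (Q : Measure ℝ) : EReal :=
  ((∫⁻ x, ENNReal.ofReal (f x) ∂Q : ℝ≥0∞) : EReal) -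
    ((∫⁻ x, ENNReal.ofReal (-f x) ∂Q : ℝ≥0∞) : EReal)

/-- `Σ`: the probability measures `Q` on `ℝ` with `∫ F dQ - μ > ε`, where `μ = ∫ F dP`. -/
def sigmaSet (P : Measure ℝ) (F : ℝ → ℝ) (ε : ℝ) : Set (ProbabilityMeasure ℝ) :=
  {Q | HasExtIntegral F (Q : Measure ℝ) ∧
    extIntegral F (Q : Measure ℝ) - ((∫ x, F x ∂P : ℝ) : EReal) > (ε : EReal)}

/-- `E ⊆ Σ`: the probability measures `Q` on `ℝ` with `∫ F dQ - μ > ε` and `∫ U dQ - ν < u`,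
where `μ = ∫ F dP` and `ν = ∫ U dP`. -/
def screenedSet (P : Measure ℝ) (F U : ℝ → ℝ) (ε u : ℝ) : Set (ProbabilityMeasure ℝ) :=
  {Q | Q ∈ sigmaSet P F ε ∧ HasExtIntegral U (Q : Measure ℝ) ∧
    extIntegral U (Q : Measure ℝ) - ((∫ x, U x ∂P : ℝ) : EReal) < (u : EReal)}

/-- `H(A‖P) = inf {H(Q‖P) : Q ∈ A}`, with value `∞` for empty `A`. -/
noncomputable def infEntropy (A : Set (ProbabilityMeasure ℝ)) (P : Measure ℝ) : ℝ≥0∞ :=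
  ⨅ Q ∈ A, InformationTheory.klDiv (Q : Measure ℝ) P

/-- The essential supremum `m(β)` of `F(X) - β U(X)`, `X ∼ P`, in `[-∞, ∞]`. -/
noncomputable def domBound (P : Measure ℝ) (F U : ℝ → ℝ) (β : ℝ) : EReal :=
  essSup (fun x => ((F x - β * U x : ℝ) : EReal)) P

/-- The partial sum `∑ G(X_i)` of the first `n` samples. -/
noncomputable def partialSum {Ω : Type*} (G : ℝ → ℝ) (X : ℕ → Ω → ℝ) (n : ℕ) (ω : Ω) : ℝ :=
  ∑ i ∈ Finset.range n, G (X i ω)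

end ScreenedEstimation

/-! Both rates come from entropy bounds for the product law `P^n`.

Lower bound (`eventually_exp_le_two_mul_pi`): if `Q ≪ P` has finite entropy and meets the strict
mean constraints, the event has `Q^n`-probability tending to 1 by the law of large numbers, and
there `dQ^n/dP^n` is at most about `exp(n H(Q‖P))`.

Upper bound (`natCast_mul_integral_llr_averageLaw_le`): condition `P^n` on the event and average the
marginals. The resulting law meets the mean constraints and has entropy at most `-log P^n(event) /
n`, for every `n ≥ 1`.

The infimum over `Σ` vanishes because, with a heavy tail, an arbitrarily weak exponential tilt of a
truncation of `F` reaches any prescribed mean above `μ` (`exists_law_integral_ge_of_heavy_tailed`).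
The infimum over `E` is positive because `W = F - βU` with `β = ε/(2u)` is bounded above, while its
mean must rise by at least `ε/2` on `E`; this costs entropy (`exists_pos_le_integral_llr`).
Domination also makes every `Q ≪ P` in `E` integrate `F` and `U`, so the lower bound applies to it.
-/

namespace ScreenedEstimation

/-! ### Densities of product measures. -/

section ProductDensity

variable {α : Type*} [MeasurableSpace α]

/-- It suffices to compare boxes, where the integral factors by independence of the coordinates. -/
theorem pi_withDensity {ι : Type*} [Fintype ι] (P : Measure α) [IsProbabilityMeasure P]
    {g : α → ℝ≥0∞} (hg : Measurable g) [SigmaFinite (P.withDensity g)] :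
    Measure.pi (fun _ : ι => P.withDensity g) =
      (Measure.pi fun _ : ι => P).withDensity fun x => ∏ i, g (x i) := by
  refine Measure.pi_eq fun s hs => ?_
  have hind : iIndepFun (fun (i : ι) (x : ι → α) => (s i).indicator g (x i))
      (Measure.pi fun _ : ι => P) :=
    iIndepFun_pi (X := fun i => (s i).indicator g) fun i => (hg.indicator (hs i)).aemeasurable
  have hm : ∀ i, Measurable fun x : ι → α => (s i).indicator g (x i) := fun i =>
    (hg.indicator (hs i)).comp (measurable_pi_apply i)
  have hprod := lintegral_prod_eq_prod_lintegral_of_indepFun Finset.univ _ hind hm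
  rw [withDensity_apply _ (MeasurableSet.univ_pi hs),
    ← lintegral_indicator (MeasurableSet.univ_pi hs)]
  have hpt : ∀ x : ι → α, (Set.univ.pi s).indicator (fun x => ∏ i, g (x i)) x =
      ∏ i, (s i).indicator g (x i) := by
    intro x
    by_cases hx : x ∈ Set.univ.pi s
    · rw [Set.indicator_of_mem hx]
      exact Finset.prod_congr rfl fun i _ => (Set.indicator_of_mem (hx i trivial) g).symm
    · rw [Set.indicator_of_notMem hx]
      obtain ⟨i, hi⟩ : ∃ i, x i ∉ s i := by simpa [Set.mem_pi] using hx
      exact (Finset.prod_eq_zero (Finset.mem_univ i) (Set.indicator_of_notMem hi g)).symm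
  simp_rw [hpt]
  rw [hprod]
  refine Finset.prod_congr rfl fun i _ => ?_
  rw [withDensity_apply _ (hs i), ← lintegral_indicator (hs i)]
  exact (measurePreserving_eval (fun _ : ι => P) i).lintegral_comp (hg.indicator (hs i))

/-- The density `dQ/dP`, modified on a null set so as to be finite everywhere. -/
noncomputable def density (Q P : Measure α) (x : α) : ℝ≥0∞ :=
  ENNReal.ofReal (Q.rnDeriv P x).toReal

theorem measurable_density (Q P : Measure α) : Measurable (density Q P) :=
  (Measure.measurable_rnDeriv Q P).ennreal_toReal.ennreal_ofReal

theorem withDensity_density {Q P : Measure α} [IsFiniteMeasure Q] [IsFiniteMeasure P]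
    (h : Q ≪ P) : P.withDensity (density Q P) = Q := by
  conv_rhs => rw [← Measure.withDensity_rnDeriv_eq Q P h]
  refine withDensity_congr_ae ?_
  filter_upwards [Measure.rnDeriv_lt_top Q P] with x hx
  exact ENNReal.ofReal_toReal hx.ne

theorem pi_eq_withDensity {ι : Type*} [Fintype ι] {Q P : Measure α} [IsProbabilityMeasure Q]
    [IsProbabilityMeasure P] (h : Q ≪ P) :
    Measure.pi (fun _ : ι => Q) =
      (Measure.pi fun _ : ι => P).withDensity fun x => ∏ i, density Q P (x i) := by
  have hQ := withDensity_density h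
  have : IsProbabilityMeasure (P.withDensity (density Q P)) := by rw [hQ]; infer_instance
  have := pi_withDensity (ι := ι) P (measurable_density Q P)
  rwa [hQ] at this

/-- Only an inequality: where the density vanishes, `Real.log 0 = 0` makes the exponential factor 1.
-/
theorem prod_density_le_exp {ι : Type*} [Fintype ι] (Q P : Measure α) (x : ι → α) :
    ∏ i, density Q P (x i) ≤ ENNReal.ofReal (Real.exp (∑ i, llr Q P (x i))) := by
  rw [Real.exp_sum, ENNReal.ofReal_prod_of_nonneg fun i _ => (Real.exp_pos _).le]
  exact Finset.prod_le_prod' fun i _ => ENNReal.ofReal_le_ofReal (Real.le_exp_log _)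

end ProductDensity

/-! ### Lower bound by change of measure. -/

section LowerBound

variable {α : Type*} [MeasurableSpace α]

/-- The samples whose empirical means of `F` and `U` lie above `a` and below `b`. -/
def meanEvent (F U : α → ℝ) (a b : ℝ) (n : ℕ) : Set (Fin n → α) :=
  {x | n * a < ∑ i, F (x i) ∧ ∑ i, U (x i) < n * b}

theorem measurableSet_meanEvent {F U : α → ℝ} (hF : Measurable F) (hU : Measurable U) (a b : ℝ)
    (n : ℕ) : MeasurableSet (meanEvent F U a b n) := by
  unfold meanEvent
  measurability

theorem ae_tendsto_empirical_mean (Q : Measure α) [IsProbabilityMeasure Q] {f : α → ℝ}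
    (hf : Measurable f) (hfi : Integrable f Q) :
    ∀ᵐ ω ∂Measure.infinitePi (fun _ : ℕ => Q),
      Tendsto (fun n : ℕ => (∑ i : Fin n, f (ω i)) / n) atTop (𝓝 (∫ x, f x ∂Q)) := by
  have hmp : ∀ i : ℕ, MeasurePreserving (Function.eval i) (Measure.infinitePi fun _ : ℕ => Q) Q :=
    fun i => measurePreserving_eval_infinitePi (fun _ : ℕ => Q) i
  have hid : ∀ i : ℕ, IdentDistrib (fun ω : ℕ → α => f (ω i)) (fun ω : ℕ → α => f (ω 0))
      (Measure.infinitePi fun _ : ℕ => Q) (Measure.infinitePi fun _ : ℕ => Q) := fun i =>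
    (IdentDistrib.mk (measurable_pi_apply i).aemeasurable (measurable_pi_apply 0).aemeasurable
      ((hmp i).map_eq.trans (hmp 0).map_eq.symm)).comp hf
  have hind := iIndepFun_infinitePi (P := fun _ : ℕ => Q) (X := fun _ => f) fun _ => hf
  have := strong_law_ae_real (fun i (ω : ℕ → α) => f (ω i))
    ((hmp 0).integrable_comp_of_integrable hfi) (fun i j hij => hind.indepFun hij) hid
  filter_upwards [this] with ω hω
  have h0 : ∫ ω : ℕ → α, f (ω 0) ∂(Measure.infinitePi fun _ : ℕ => Q) = ∫ x, f x ∂Q := by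
    exact (hmp 0).hasLaw.integral_comp hf.aestronglyMeasurable
  rw [h0] at hω
  simpa only [Fin.sum_univ_eq_sum_range (fun i => f (ω i))] using hω

theorem pi_eq_infinitePi_preimage (Q : Measure α) [IsProbabilityMeasure Q] {n : ℕ}
    {s : Set (Fin n → α)} (hs : MeasurableSet s) :
    Measure.pi (fun _ : Fin n => Q) s =
      Measure.infinitePi (fun _ : ℕ => Q) {ω | (fun i : Fin n => ω i) ∈ s} := by
  have hind := (iIndepFun_infinitePi (P := fun _ : ℕ => Q) (X := fun _ x => x)
    fun _ => measurable_id).precomp (g := fun i : Fin n => (i : ℕ)) Fin.val_injective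
  have hlaw := iIndepFun.hasLaw_pi (μ := fun _ : Fin n => Q)
    (X := fun (i : Fin n) (ω : ℕ → α) => ω i)
    (fun i => (measurePreserving_eval_infinitePi (fun _ : ℕ => Q) i).hasLaw) hind
  exact (hlaw.measure_eq (p := fun x => x ∈ s) hs).symm

/-- The factor 2 arises from waiting only until the `Q^n`-mass of the good event exceeds 1/2. -/
theorem eventually_exp_le_two_mul_pi {Q P : Measure α} [IsProbabilityMeasure Q]
    [IsProbabilityMeasure P] (hQP : Q ≪ P) (hllr : Integrable (llr Q P) Q) {F U : α → ℝ}
    (hF : Measurable F) (hU : Measurable U) (hFi : Integrable F Q) (hUi : Integrable U Q)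
    {a b r : ℝ} (ha : a < ∫ x, F x ∂Q) (hb : ∫ x, U x ∂Q < b) (hr : ∫ x, llr Q P x ∂Q < r) :
    ∀ᶠ n : ℕ in atTop, ENNReal.ofReal (Real.exp (-(n * r))) ≤
      2 * Measure.pi (fun _ : Fin n => P) (meanEvent F U a b n) := by
  have hl := measurable_llr Q P
  -- The added constraint bounds the density of `Q^n` by `exp (n * r)` on `G n`, and still holds
  -- with `Q^n`-probability tending to 1.
  let G : (n : ℕ) → Set (Fin n → α) := fun n =>
    meanEvent F U a b n ∩ {x | ∑ i, llr Q P (x i) < n * r}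
  have hG : ∀ n, MeasurableSet (G n) := fun n =>
    (measurableSet_meanEvent hF hU a b n).inter
      (measurableSet_lt (by fun_prop) measurable_const)
  have hlim : Tendsto (fun n : ℕ => Measure.infinitePi (fun _ : ℕ => Q)
      {ω | (fun i : Fin n => ω i) ∈ G n}) atTop
      (𝓝 (Measure.infinitePi (fun _ : ℕ => Q) Set.univ)) := by
    refine tendsto_measure_of_ae_tendsto_indicator_of_isFiniteMeasure atTop MeasurableSet.univ
      (fun n => hG n |>.preimage (by fun_prop)) ?_
    filter_upwards [ae_tendsto_empirical_mean Q hF hFi, ae_tendsto_empirical_mean Q hU hUi,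
      ae_tendsto_empirical_mean Q hl hllr] with ω h1 h2 h3
    filter_upwards [h1.eventually_const_lt ha, h2.eventually_lt_const hb,
      h3.eventually_lt_const hr, eventually_gt_atTop 0] with n k1 k2 k3 hn
    have hn' : (0 : ℝ) < n := by exact_mod_cast hn
    rw [lt_div_iff₀ hn', mul_comm] at k1
    rw [div_lt_iff₀ hn', mul_comm] at k2 k3
    exact iff_of_true ⟨⟨k1, k2⟩, k3⟩ trivial
  rw [measure_univ] at hlim
  have hhalf : (2 : ℝ≥0∞)⁻¹ < 1 := ENNReal.inv_lt_one.2 (by norm_num)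
  filter_upwards [hlim.eventually_const_lt hhalf] with n hn
  rw [← pi_eq_infinitePi_preimage Q (hG n), pi_eq_withDensity hQP,
    withDensity_apply _ (hG n)] at hn
  have hle : ∫⁻ x in G n, ∏ i, density Q P (x i) ∂(Measure.pi fun _ : Fin n => P) ≤
      ENNReal.ofReal (Real.exp (n * r)) *
        Measure.pi (fun _ : Fin n => P) (meanEvent F U a b n) := by
    calc _ ≤ ∫⁻ _ in G n, ENNReal.ofReal (Real.exp (n * r)) ∂(Measure.pi fun _ : Fin n => P) :=
          setLIntegral_mono' (hG n) fun x hx => (prod_density_le_exp Q P x).trans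
            (ENNReal.ofReal_le_ofReal (Real.exp_le_exp.2 hx.2.le))
      _ ≤ _ := by
          rw [setLIntegral_const]
          gcongr
          exact Set.inter_subset_left
  have h2 := hn.le.trans hle
  rw [Real.exp_neg, ENNReal.ofReal_inv_of_pos (Real.exp_pos _)]
  have hE0 : ENNReal.ofReal (Real.exp (n * r)) ≠ 0 := by simp [Real.exp_pos]
  calc (ENNReal.ofReal (Real.exp (n * r)))⁻¹
      = (ENNReal.ofReal (Real.exp (n * r)))⁻¹ * (2 * 2⁻¹) := by
        rw [ENNReal.mul_inv_cancel (by simp) (by simp), mul_one]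
    _ ≤ (ENNReal.ofReal (Real.exp (n * r)))⁻¹ * (2 * (ENNReal.ofReal (Real.exp (n * r)) *
          Measure.pi (fun _ : Fin n => P) (meanEvent F U a b n))) := by gcongr
    _ = _ := by
        rw [mul_left_comm, ← mul_assoc _ _ (Measure.pi _ _),
          ENNReal.inv_mul_cancel hE0 ENNReal.ofReal_ne_top, one_mul]

end LowerBound

/-! ### Upper bound by conditioning and averaging marginals. -/

section UpperBound

variable {α : Type*} [MeasurableSpace α]

theorem lt_integral_of_ae_lt {μ : Measure α} [IsProbabilityMeasure μ] {f : α → ℝ} {a : ℝ}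
    (hf : Integrable f μ) (h : ∀ᵐ x ∂μ, a < f x) : a < ∫ x, f x ∂μ := by
  have h0 : 0 < ∫ x, (f x - a) ∂μ := by
    rw [integral_pos_iff_support_of_nonneg_ae
      (h.mono fun x hx => (sub_pos.2 hx).le) (hf.sub (integrable_const a))]
    have : ∀ᵐ x ∂μ, x ∈ Function.support fun x => f x - a :=
      h.mono fun x hx => (sub_pos.2 hx).ne'
    exact prob_compl_eq_zero_iff₀ (hf.aestronglyMeasurable.sub
      aestronglyMeasurable_const).nullMeasurableSet_support |>.1 this ▸ one_pos
  rw [integral_sub hf (integrable_const a)] at h0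
  simpa using h0

theorem integral_lt_of_ae_lt {μ : Measure α} [IsProbabilityMeasure μ] {f : α → ℝ} {a : ℝ}
    (hf : Integrable f μ) (h : ∀ᵐ x ∂μ, f x < a) : ∫ x, f x ∂μ < a := by
  have := lt_integral_of_ae_lt hf.neg (h.mono fun x hx => neg_lt_neg hx)
  simpa only [Pi.neg_apply, integral_neg, neg_lt_neg_iff] using this

/-- The average of the marginals of a measure on `Fin n → α`. -/
noncomputable def averageLaw {n : ℕ} (C : Measure (Fin n → α)) : Measure α :=
  (n : ℝ≥0∞)⁻¹ • ∑ i, C.map fun x => x i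

theorem natCast_smul_averageLaw {n : ℕ} (hn : n ≠ 0) (C : Measure (Fin n → α)) :
    (n : ℝ≥0∞) • averageLaw C = ∑ i, C.map fun x => x i := by
  rw [averageLaw, smul_smul, ENNReal.mul_inv_cancel (by exact_mod_cast hn) (by simp), one_smul]

theorem isProbabilityMeasure_averageLaw {n : ℕ} (hn : n ≠ 0) (C : Measure (Fin n → α))
    [IsProbabilityMeasure C] : IsProbabilityMeasure (averageLaw C) := by
  constructor
  simp only [averageLaw, Measure.smul_apply, Measure.finsetSum_apply, smul_eq_mul]
  have : ∀ i : Fin n, C.map (fun x => x i) Set.univ = 1 := fun i => by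
    rw [Measure.map_apply (measurable_pi_apply i) MeasurableSet.univ, Set.preimage_univ,
      measure_univ]
  simp only [this, Finset.sum_const, Finset.card_univ, Fintype.card_fin, nsmul_eq_mul, mul_one]
  exact ENNReal.inv_mul_cancel (by exact_mod_cast hn) (by simp)

theorem map_le_averageLaw {n : ℕ} (C : Measure (Fin n → α)) (i : Fin n) :
    C.map (fun x => x i) ≤ (n : ℝ≥0∞) • averageLaw C := by
  rw [natCast_smul_averageLaw (Nat.ne_zero_of_lt i.2)]
  refine Measure.le_intro fun s _ _ => ?_
  rw [Measure.finsetSum_apply]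
  exact Finset.single_le_sum (f := fun j => C.map (fun x => x j) s) (fun _ _ => zero_le)
    (Finset.mem_univ i)

theorem averageLaw_le {n : ℕ} (hn : n ≠ 0) {C : Measure (Fin n → α)} {P : Measure α}
    [IsProbabilityMeasure P] {k : ℝ≥0∞} (h : C ≤ k • Measure.pi fun _ => P) :
    averageLaw C ≤ k • P := by
  have hi : ∀ i : Fin n, C.map (fun x => x i) ≤ k • P := fun i => by
    refine (Measure.map_mono h (measurable_pi_apply i)).trans_eq ?_
    rw [Measure.map_smul]
    exact congrArg _ (measurePreserving_eval (fun _ : Fin n => P) i).map_eq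
  refine Measure.le_intro fun s _ _ => ?_
  simp only [averageLaw, Measure.smul_apply, Measure.finsetSum_apply, smul_eq_mul]
  calc (n : ℝ≥0∞)⁻¹ * ∑ i : Fin n, C.map (fun x => x i) s
      ≤ (n : ℝ≥0∞)⁻¹ * ∑ _i : Fin n, k * P s := by
        gcongr with i
        exact hi i s
    _ = k * P s := by
        rw [Finset.sum_const, Finset.card_univ, Fintype.card_fin, nsmul_eq_mul, ← mul_assoc,
          ENNReal.inv_mul_cancel (by exact_mod_cast hn) (by simp), one_mul]

theorem integrable_eval_of_averageLaw {n : ℕ} {C : Measure (Fin n → α)} {f : α → ℝ}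
    (hfi : Integrable f (averageLaw C)) (i : Fin n) : Integrable (fun x => f (x i)) C :=
  ((hfi.smul_measure (ENNReal.natCast_ne_top n)).mono_measure
    (map_le_averageLaw C i)).comp_measurable (measurable_pi_apply i)

/-- A sum over coordinates sees only the marginals, so mean constraints on the sample become
constraints on the averaged law. -/
theorem natCast_mul_integral_averageLaw {n : ℕ} (hn : n ≠ 0) {C : Measure (Fin n → α)}
    {f : α → ℝ} (hf : Measurable f) (hfi : Integrable f (averageLaw C)) :
    n * ∫ x, f x ∂averageLaw C = ∫ x, ∑ i, f (x i) ∂C := by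
  have h : ∀ i : Fin n, Integrable f (C.map fun x => x i) := fun i =>
    (hfi.smul_measure (ENNReal.natCast_ne_top n)).mono_measure (map_le_averageLaw C i)
  have h1 := integral_smul_measure (μ := averageLaw C) f (n : ℝ≥0∞)
  rw [natCast_smul_averageLaw hn, integral_finsetSum_measure fun i _ => h i] at h1
  rw [integral_finsetSum _ fun i _ => integrable_eval_of_averageLaw hfi i]
  simp only [ENNReal.toReal_natCast, smul_eq_mul] at h1
  rw [← h1]
  exact Finset.sum_congr rfl fun i _ =>
    integral_map (measurable_pi_apply i).aemeasurable hf.aestronglyMeasurable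

theorem rnDeriv_le_of_le_smul {Q P : Measure α} [IsFiniteMeasure Q] [IsFiniteMeasure P]
    {k : ℝ≥0∞} (h : Q ≤ k • P) : ∀ᵐ x ∂P, Q.rnDeriv P x ≤ k := by
  refine ae_le_of_forall_setLIntegral_le_of_sigmaFinite (Measure.measurable_rnDeriv Q P)
    fun s _ _ => ?_
  rw [setLIntegral_const]
  exact (Measure.setLIntegral_rnDeriv_le s).trans (h s)

/-- The density is bounded by `k`, and `t log t` is bounded on `[0, k]`. -/
theorem integrable_llr_of_le_smul {Q P : Measure α} [IsFiniteMeasure Q] [IsFiniteMeasure P]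
    {k : ℝ≥0∞} (hk : k ≠ ⊤) (h : Q ≤ k • P) : Integrable (llr Q P) Q := by
  have hQP : Q ≪ P := (Measure.absolutelyContinuous_of_le h).trans
    Measure.smul_absolutelyContinuous
  rw [← integrable_rnDeriv_mul_log_iff hQP]
  obtain ⟨c, hc⟩ := (isCompact_Icc (a := (0 : ℝ)) (b := k.toReal)).exists_bound_of_continuousOn
    Real.continuous_mul_log.continuousOn
  refine Integrable.of_bound (C := c) ?_ ?_
  · have := (Measure.measurable_rnDeriv Q P).ennreal_toReal
    exact (this.mul this.log).aestronglyMeasurable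
  · filter_upwards [rnDeriv_le_of_le_smul h] with x hx
    exact hc _ ⟨ENNReal.toReal_nonneg, ENNReal.toReal_mono hk hx⟩

theorem cond_le_inv_smul (ρ : Measure α) (A : Set α) : ρ[|A] ≤ (ρ A)⁻¹ • ρ := by
  refine Measure.le_intro fun s _ _ => ?_
  simp only [ProbabilityTheory.cond, Measure.smul_apply, smul_eq_mul]
  gcongr
  exact Measure.restrict_le_self

/-- Conditioning a product measure on an event `A` and averaging the marginals yields a law whose
relative entropy is at most `-log (Pⁿ A) / n`. -/
theorem natCast_mul_integral_llr_averageLaw_le {n : ℕ} (hn : n ≠ 0) {P : Measure α}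
    [IsProbabilityMeasure P] {A : Set (Fin n → α)} (hA : MeasurableSet A)
    (hA0 : Measure.pi (fun _ : Fin n => P) A ≠ 0) :
    n * ∫ x, llr (averageLaw (Measure.pi (fun _ : Fin n => P))[|A]) P x
        ∂averageLaw (Measure.pi (fun _ : Fin n => P))[|A] ≤
      -Real.log (Measure.pi (fun _ : Fin n => P) A).toReal := by
  set ρ := Measure.pi fun _ : Fin n => P
  have : IsProbabilityMeasure ρ[|A] := cond_isProbabilityMeasure hA0
  set Q := averageLaw ρ[|A]
  have : IsProbabilityMeasure Q := isProbabilityMeasure_averageLaw hn _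
  have hCle := cond_le_inv_smul ρ A
  have hQle : Q ≤ (ρ A)⁻¹ • P := averageLaw_le hn hCle
  have hQP : Q ≪ P := (Measure.absolutelyContinuous_of_le hQle).trans
    Measure.smul_absolutelyContinuous
  have hllr : Integrable (llr Q P) Q := integrable_llr_of_le_smul (ENNReal.inv_ne_top.2 hA0) hQle
  rw [natCast_mul_integral_averageLaw hn (measurable_llr Q P) hllr]
  set c := (ρ A).toReal
  have hc : 0 < c := ENNReal.toReal_pos hA0 (measure_ne_top ρ A)
  -- The density of `Q^n` with respect to `ρ = P^n`.
  set h : (Fin n → α) → ℝ := fun x => ∏ i, (Q.rnDeriv P (x i)).toReal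
  have hh : Measurable h := Finset.measurable_prod _ fun i _ =>
    ((Measure.measurable_rnDeriv Q P).comp (measurable_pi_apply i)).ennreal_toReal
  have hh0 : ∀ x, 0 ≤ h x := fun x => Finset.prod_nonneg fun i _ => ENNReal.toReal_nonneg
  have hdens : ∀ x, ENNReal.ofReal (h x) = ∏ i, density Q P (x i) := fun x =>
    ENNReal.ofReal_prod_of_nonneg fun i _ => ENNReal.toReal_nonneg
  -- Conditioning divides by `ρ A`, so this integral is exactly `Q^n(A)`.
  have hle : ∫⁻ x, ENNReal.ofReal (c * h x) ∂ρ[|A] ≤ 1 := by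
    calc ∫⁻ x, ENNReal.ofReal (c * h x) ∂ρ[|A]
        = ρ A * ∫⁻ x, ∏ i, density Q P (x i) ∂ρ[|A] := by
          rw [← lintegral_const_mul' _ _ (measure_ne_top ρ A)]
          refine lintegral_congr fun x => ?_
          rw [ENNReal.ofReal_mul hc.le, hdens, ENNReal.ofReal_toReal (measure_ne_top ρ A)]
      _ = ∫⁻ x in A, ∏ i, density Q P (x i) ∂ρ := by
          rw [ProbabilityTheory.cond, lintegral_smul_measure, smul_eq_mul, ← mul_assoc,
            ENNReal.mul_inv_cancel hA0 (measure_ne_top ρ A), one_mul]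
      _ = Measure.pi (fun _ : Fin n => Q) A := by
          rw [pi_eq_withDensity hQP, withDensity_apply _ hA]
      _ ≤ 1 := prob_le_one
  have hint : Integrable (fun x => c * h x) ρ[|A] := by
    refine ⟨(hh.const_mul c).aestronglyMeasurable, ?_⟩
    rw [hasFiniteIntegral_iff_ofReal (Eventually.of_forall fun x => mul_nonneg hc.le (hh0 x))]
    exact hle.trans_lt ENNReal.one_lt_top
  have hint1 : ∫ x, c * h x ∂ρ[|A] ≤ 1 := by
    rw [integral_eq_lintegral_of_nonneg_ae
      (Eventually.of_forall fun x => mul_nonneg hc.le (hh0 x)) hint.1]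
    exact ENNReal.toReal_le_of_le_ofReal zero_le_one (by simpa using hle)
  have hpos : ∀ i, ∀ᵐ x ∂ρ[|A], 0 < (Q.rnDeriv P (x i)).toReal := fun i => by
    have h1 : ∀ᵐ y ∂Q, 0 < (Q.rnDeriv P y).toReal := by
      filter_upwards [Measure.rnDeriv_pos hQP, hQP.ae_le (Measure.rnDeriv_lt_top Q P)]
        with y h1 h2 using ENNReal.toReal_pos h1.ne' h2.ne
    have h2 : ∀ᵐ y ∂(ρ[|A]).map (fun x => x i), 0 < (Q.rnDeriv P y).toReal :=
      ((Measure.absolutelyContinuous_of_le (map_le_averageLaw ρ[|A] i)).trans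
        Measure.smul_absolutelyContinuous).ae_le h1
    exact ae_of_ae_map (measurable_pi_apply i).aemeasurable h2
  -- The inequality `log t ≤ t - 1` at `t = c * h x` does the work of Jensen's inequality.
  have hmain : ∀ᵐ x ∂ρ[|A], ∑ i, llr Q P (x i) ≤ c * h x - (1 + Real.log c) := by
    filter_upwards [ae_all_iff.2 hpos] with x hx
    have hp : 0 < h x := Finset.prod_pos fun i _ => hx i
    have hl : ∑ i, llr Q P (x i) = Real.log (h x) :=
      (Real.log_prod fun i _ => (hx i).ne').symm
    have := Real.log_le_sub_one_of_pos (mul_pos hc hp)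
    rw [Real.log_mul hc.ne' hp.ne'] at this
    linarith
  calc ∫ x, ∑ i, llr Q P (x i) ∂ρ[|A]
      ≤ ∫ x, (c * h x - (1 + Real.log c)) ∂ρ[|A] :=
        integral_mono_ae (integrable_finsetSum _ fun i _ => integrable_eval_of_averageLaw hllr i)
          (hint.sub (integrable_const _)) hmain
    _ = ∫ x, c * h x ∂ρ[|A] - (1 + Real.log c) := by
        rw [integral_sub hint (integrable_const _)]
        simp
    _ ≤ -Real.log c := by linarith

theorem exists_law_of_pi_meanEvent_ne_zero {n : ℕ} (hn : n ≠ 0) {P : Measure α}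
    [IsProbabilityMeasure P] {F U : α → ℝ} (hF : Measurable F) (hU : Measurable U)
    (hFi : Integrable F P) (hUi : Integrable U P) {a b : ℝ}
    (hA0 : Measure.pi (fun _ : Fin n => P) (meanEvent F U a b n) ≠ 0) :
    ∃ Q : Measure α, IsProbabilityMeasure Q ∧ Q ≪ P ∧ Integrable (llr Q P) Q ∧
      Integrable F Q ∧ Integrable U Q ∧ a < ∫ x, F x ∂Q ∧ ∫ x, U x ∂Q < b ∧
      n * ∫ x, llr Q P x ∂Q ≤
        -Real.log (Measure.pi (fun _ : Fin n => P) (meanEvent F U a b n)).toReal := by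
  have hA := measurableSet_meanEvent hF hU a b n
  have hmain := natCast_mul_integral_llr_averageLaw_le hn hA hA0
  set ρ := Measure.pi fun _ : Fin n => P
  set A := meanEvent F U a b n
  have : IsProbabilityMeasure ρ[|A] := cond_isProbabilityMeasure hA0
  have hCle := cond_le_inv_smul ρ A
  have hQle : averageLaw ρ[|A] ≤ (ρ A)⁻¹ • P := averageLaw_le hn hCle
  have hk : (ρ A)⁻¹ ≠ ⊤ := ENNReal.inv_ne_top.2 hA0
  have hQ := isProbabilityMeasure_averageLaw hn ρ[|A]
  have hFQ : Integrable F (averageLaw ρ[|A]) := (hFi.smul_measure hk).mono_measure hQle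
  have hUQ : Integrable U (averageLaw ρ[|A]) := (hUi.smul_measure hk).mono_measure hQle
  have hmem := ae_cond_mem (μ := ρ) hA
  have hn' : (0 : ℝ) < n := by exact_mod_cast hn.bot_lt
  refine ⟨averageLaw ρ[|A], hQ, (Measure.absolutelyContinuous_of_le hQle).trans
    Measure.smul_absolutelyContinuous, integrable_llr_of_le_smul hk hQle, hFQ, hUQ, ?_, ?_, hmain⟩
  · refine lt_of_mul_lt_mul_left ?_ hn'.le
    rw [natCast_mul_integral_averageLaw hn hF hFQ]
    exact lt_integral_of_ae_lt (integrable_finsetSum _ fun i _ =>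
      integrable_eval_of_averageLaw hFQ i) (hmem.mono fun x hx => hx.1)
  · refine lt_of_mul_lt_mul_left ?_ hn'.le
    rw [natCast_mul_integral_averageLaw hn hU hUQ]
    exact integral_lt_of_ae_lt (integrable_finsetSum _ fun i _ =>
      integrable_eval_of_averageLaw hUQ i) (hmem.mono fun x hx => hx.2)

end UpperBound

/-! ### Entropy cost of raising the mean of a function bounded above. -/

section Entropy

variable {α : Type*} [MeasurableSpace α]

/-- Donsker–Varadhan inequality: the difference of the two sides is the entropy of `Q` relative to
`P.tilted f`, hence nonnegative. -/
theorem integral_sub_log_integral_exp_le {Q P : Measure α} [IsProbabilityMeasure Q]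
    [IsProbabilityMeasure P] (hQP : Q ≪ P) (hllr : Integrable (llr Q P) Q) {f : α → ℝ}
    (hfQ : Integrable f Q) (hfP : Integrable (fun x => Real.exp (f x)) P) :
    ∫ x, f x ∂Q - Real.log (∫ x, Real.exp (f x) ∂P) ≤ ∫ x, llr Q P x ∂Q := by
  have : IsProbabilityMeasure (P.tilted f) := isProbabilityMeasure_tilted hfP
  have h := InformationTheory.integral_llr_add_sub_measure_univ_nonneg
    (hQP.trans (absolutelyContinuous_tilted hfP))
    (integrable_llr_tilted_right hQP hfQ hllr hfP)
  rw [integral_llr_tilted_right hQP hfQ hfP hllr] at h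
  simp only [probReal_univ] at h
  linarith

theorem exp_le_one_add_add_sq {x : ℝ} (hx : x ≤ 1) : Real.exp x ≤ 1 + x + x ^ 2 := by
  rcases le_or_gt (-1) x with h | h
  · have := (abs_le.1 (Real.abs_exp_sub_one_sub_id_le (abs_le.2 ⟨h, hx⟩))).2
    linarith
  · have := Real.exp_le_one_iff.2 (by linarith : x ≤ 0)
    nlinarith

theorem exists_pos_le_integral_llr {P : Measure α} [IsProbabilityMeasure P] {W : α → ℝ}
    (hW : Measurable W) (hWi : Integrable W P) (hW2 : Integrable (fun x => W x ^ 2) P) {m : ℝ}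
    (hm : ∀ᵐ x ∂P, W x ≤ m) {δ : ℝ} (hδ : 0 < δ) :
    ∃ κ : ℝ, 0 < κ ∧ ∀ Q : Measure α, IsProbabilityMeasure Q → Q ≪ P → Integrable (llr Q P) Q →
      Integrable W Q → ∫ x, W x ∂P + δ ≤ ∫ x, W x ∂Q → κ ≤ ∫ x, llr Q P x ∂Q := by
  set V := ∫ x, W x ^ 2 ∂P
  have hV : 0 ≤ V := integral_nonneg fun x => sq_nonneg _
  -- The first bound permits the quadratic estimate of `exp (θ * W)`; the second makes the quadratic
  -- loss `θ ^ 2 * V` at most half of the linear gain `θ * δ`.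
  obtain ⟨θ, hθ, hθm, hθV⟩ : ∃ θ : ℝ, 0 < θ ∧ θ * m ≤ 1 ∧ θ * V ≤ δ / 2 := by
    refine ⟨min (1 / (|m| + 1)) (δ / (2 * (V + 1))), by positivity, ?_, ?_⟩
    · calc min (1 / (|m| + 1)) (δ / (2 * (V + 1))) * m
          ≤ min (1 / (|m| + 1)) (δ / (2 * (V + 1))) * (|m| + 1) := by
            gcongr
            linarith [le_abs_self m]
        _ ≤ 1 / (|m| + 1) * (|m| + 1) := by
            gcongr
            exact min_le_left _ _
        _ = 1 := by field_simp
    · calc min (1 / (|m| + 1)) (δ / (2 * (V + 1))) * V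
          ≤ δ / (2 * (V + 1)) * (V + 1) := by
            gcongr
            · exact min_le_right _ _
            · linarith
        _ = δ / 2 := by field_simp
  have hpt : ∀ᵐ x ∂P, Real.exp (θ * W x) ≤ 1 + θ * W x + (θ * W x) ^ 2 :=
    hm.mono fun x hx => exp_le_one_add_add_sq ((mul_le_mul_of_nonneg_left hx hθ.le).trans hθm)
  have hi1 : Integrable (fun x => 1 + θ * W x) P := (integrable_const _).add (hWi.const_mul θ)
  have hi2 : Integrable (fun x => (θ * W x) ^ 2) P := by
    simpa only [mul_pow] using hW2.const_mul (θ ^ 2)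
  have hexp : Integrable (fun x => Real.exp (θ * W x)) P := by
    refine (hi1.add hi2).mono' (hW.const_mul θ).exp.aestronglyMeasurable ?_
    filter_upwards [hpt] with x hx
    rw [Real.norm_of_nonneg (Real.exp_pos _).le]
    exact hx
  have hlog : Real.log (∫ x, Real.exp (θ * W x) ∂P) ≤ θ * ∫ x, W x ∂P + θ ^ 2 * V := by
    refine (Real.log_le_sub_one_of_pos (integral_exp_pos hexp)).trans ?_
    have h := integral_mono_ae hexp (hi1.add hi2) hpt
    have h' : ∫ x, (1 + θ * W x + (θ * W x) ^ 2) ∂P = 1 + θ * ∫ x, W x ∂P + θ ^ 2 * V := by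
      rw [integral_add hi1 hi2, integral_add (integrable_const _) (hWi.const_mul θ),
        integral_const_mul]
      simp only [mul_pow]
      rw [integral_const_mul]
      simp [V]
    have h'' : ∫ x, Real.exp (θ * W x) ∂P ≤ 1 + θ * ∫ x, W x ∂P + θ ^ 2 * V := h.trans_eq h'
    linarith
  refine ⟨θ * δ / 2, by positivity, fun Q _ hQP hllr hWQ hgap => ?_⟩
  have h := integral_sub_log_integral_exp_le hQP hllr (hWQ.const_mul θ) hexp
  rw [integral_const_mul] at h
  nlinarith [mul_le_mul_of_nonneg_left hgap hθ.le, mul_le_mul_of_nonneg_left hθV hθ.le]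

end Entropy

/-! ### Cheap laws with large mean under a heavy tail. -/

section HeavyTail

variable {α : Type*} [MeasurableSpace α]

/-- Monotone convergence as the truncation level grows. -/
theorem exists_exp_le_integral_exp_min {P : Measure α} [IsProbabilityMeasure P] {F : α → ℝ}
    (hF : Measurable F) {θ : ℝ} (hθ : 0 < θ)
    (h : ∫⁻ x, ENNReal.ofReal (Real.exp (θ * F x)) ∂P = ⊤) (K : ℝ) :
    ∃ M : ℕ, K ≤ ∫ x, Real.exp (θ * min (F x) M) ∂P := by
  have hm : ∀ M : ℕ, Measurable fun x => Real.exp (θ * min (F x) M) := fun M =>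
    ((hF.min measurable_const).const_mul θ).exp
  have hlim : Tendsto (fun M : ℕ => ∫⁻ x, ENNReal.ofReal (Real.exp (θ * min (F x) M)) ∂P) atTop
      (𝓝 (∫⁻ x, ENNReal.ofReal (Real.exp (θ * F x)) ∂P)) := by
    refine lintegral_tendsto_of_tendsto_of_monotone
      (fun M => (hm M).ennreal_ofReal.aemeasurable) (Eventually.of_forall fun x M N hMN => ?_)
      (Eventually.of_forall fun x => ?_)
    · have : (M : ℝ) ≤ N := by exact_mod_cast hMN
      exact ENNReal.ofReal_le_ofReal (by gcongr)
    · refine tendsto_const_nhds.congr' ?_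
      obtain ⟨N, hN⟩ := exists_nat_ge (F x)
      filter_upwards [eventually_ge_atTop N] with M hM
      rw [min_eq_left (hN.trans (by exact_mod_cast hM))]
  rw [h] at hlim
  obtain ⟨M, hM⟩ := (hlim.eventually_const_lt (ENNReal.ofReal_lt_top (r := K))).exists
  refine ⟨M, ?_⟩
  rw [integral_eq_lintegral_of_nonneg_ae (Eventually.of_forall fun x => (Real.exp_pos _).le)
    (hm M).aestronglyMeasurable]
  refine (ENNReal.ofReal_le_iff_le_toReal ?_).1 hM.le
  refine ((lintegral_mono fun x => ENNReal.ofReal_le_ofReal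
    (Real.exp_le_exp.2 (mul_le_mul_of_nonneg_left (min_le_right (F x) M) hθ.le))).trans_lt
      ?_).ne
  simp

theorem exists_law_integral_ge_of_heavy_tailed {P : Measure α} [IsProbabilityMeasure P] {F : α → ℝ}
    (hF : Measurable F) (hF0 : ∀ x, 0 ≤ F x) (hFi : Integrable F P)
    (h_heavy : ∀ θ : ℝ, 0 < θ → ∫⁻ x, ENNReal.ofReal (Real.exp (θ * F x)) ∂P = ⊤) {c : ℝ}
    (hc : ∫ x, F x ∂P ≤ c) {θ : ℝ} (hθ : 0 < θ) :
    ∃ Q : Measure α, IsProbabilityMeasure Q ∧ Q ≪ P ∧ Integrable (llr Q P) Q ∧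
      Integrable F Q ∧ c ≤ ∫ x, F x ∂Q ∧ ∫ x, llr Q P x ∂Q ≤ θ * c := by
  -- The level `exp (θ * c)` makes the cumulant generating function of the truncation at least `θ *
  -- c` at `θ`, so its slope over `[0, θ]` is at least `c`.
  obtain ⟨M, hM⟩ := exists_exp_le_integral_exp_min hF hθ (h_heavy θ hθ) (Real.exp (θ * c))
  have hc0 : 0 ≤ c := (integral_nonneg hF0).trans hc
  set G : α → ℝ := fun x => min (F x) M
  have hG : Measurable G := hF.min measurable_const
  have hG0 : ∀ x, 0 ≤ G x := fun x => le_min (hF0 x) M.cast_nonneg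
  have hGF : ∀ x, G x ≤ F x := fun x => min_le_left _ _
  have hexp : ∀ t : ℝ, Integrable (fun x => Real.exp (t * G x)) P := fun t =>
    integrable_exp_mul_of_mem_Icc (a := 0) (b := M) hG.aemeasurable
      (Eventually.of_forall fun x => ⟨hG0 x, min_le_right _ _⟩)
  have hset : interior (integrableExpSet G P) = Set.univ := by
    simp [integrableExpSet, hexp]
  have han : AnalyticOnNhd ℝ (cgf G P) Set.univ := hset ▸ analyticOnNhd_cgf
  have hθc : θ * c ≤ cgf G P θ := (Real.le_log_iff_exp_le (mgf_pos (hexp θ))).2 hM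
  obtain ⟨ξ, ⟨hξ0, hξθ⟩, hξ⟩ := exists_deriv_eq_slope (cgf G P) hθ
    (han.continuousOn.mono (Set.subset_univ _)) (han.differentiableOn.mono (Set.subset_univ _))
  have hξc : c ≤ deriv (cgf G P) ξ := by
    rw [hξ, cgf_zero, sub_zero, sub_zero, le_div_iff₀ hθ, mul_comm]
    exact hθc
  have h0c : deriv (cgf G P) 0 ≤ c := by
    rw [deriv_cgf_zero (hset ▸ Set.mem_univ 0), probReal_univ, div_one]
    refine (integral_mono_of_nonneg (Eventually.of_forall hG0) hFi
      (Eventually.of_forall hGF)).trans hc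
  -- The derivative of the cumulant generating function is the tilted mean; it passes from at most
  -- `c` at 0 to at least `c` at `ξ < θ`.
  obtain ⟨t, ⟨ht0, htξ⟩, ht⟩ := intermediate_value_Icc hξ0.le
    (han.deriv.continuousOn.mono (Set.subset_univ _)) ⟨h0c, hξc⟩
  have hbd : ∀ x, Real.exp (t * G x) ≤ Real.exp (t * M) := fun x =>
    Real.exp_le_exp.2 (mul_le_mul_of_nonneg_left (min_le_right _ _) ht0)
  have hac := tilted_absolutelyContinuous P fun x => t * G x
  have hprob : IsProbabilityMeasure (P.tilted fun x => t * G x) :=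
    isProbabilityMeasure_tilted (hexp t)
  have hFQ : Integrable F (P.tilted fun x => t * G x) := by
    rw [integrable_tilted_iff (hexp t)]
    refine hFi.bdd_mul (c := Real.exp (t * M)) (hexp t).1 (Eventually.of_forall fun x => ?_)
    rw [Real.norm_of_nonneg (Real.exp_pos _).le]
    exact hbd x
  have hGQ : Integrable G (P.tilted fun x => t * G x) :=
    hFQ.mono' hG.aestronglyMeasurable (Eventually.of_forall fun x => by
      rw [Real.norm_of_nonneg (hG0 x)]
      exact hGF x)
  have hGc : ∫ x, G x ∂(P.tilted fun x => t * G x) = c :=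
    (integral_tilted_mul_self (hset ▸ Set.mem_univ t)).trans ht
  have hl : llr (P.tilted fun x => t * G x) P =ᵐ[P.tilted fun x => t * G x]
      fun x => t * G x - Real.log (∫ x, Real.exp (t * G x) ∂P) :=
    hac.ae_le (log_rnDeriv_tilted_left_self (hexp t))
  have hli := (hGQ.const_mul t).sub (integrable_const (Real.log (∫ x, Real.exp (t * G x) ∂P)))
  refine ⟨_, hprob, hac, hli.congr hl.symm, hFQ,
    hGc ▸ integral_mono hGQ hFQ hGF, ?_⟩
  -- The entropy is `t * c` minus the logarithm of this integral; as that logarithm is nonnegative,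
  -- `t * c ≤ θ * c` remains.
  have hone : 1 ≤ ∫ x, Real.exp (t * G x) ∂P := by
    calc (1 : ℝ) = ∫ _, (1 : ℝ) ∂P := by simp
      _ ≤ _ := integral_mono (integrable_const _) (hexp t) fun x =>
          Real.one_le_exp (mul_nonneg ht0 (hG0 x))
  rw [integral_congr_ae hl, integral_sub (hGQ.const_mul t) (integrable_const _),
    integral_const_mul, hGc]
  simp only [integral_const, probReal_univ, one_smul]
  nlinarith [Real.log_nonneg hone]

end HeavyTail

/-! ### Extended integrals and membership in `Σ` and `E`. -/

section ExtendedIntegral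

theorem extIntegral_eq_integral {f : ℝ → ℝ} {Q : Measure ℝ} (hf : Integrable f Q) :
    HasExtIntegral f Q ∧ extIntegral f Q = ((∫ x, f x ∂Q : ℝ) : EReal) := by
  have h1 : ∫⁻ x, ENNReal.ofReal (f x) ∂Q ≠ ⊤ := hf.lintegral_lt_top.ne
  have h2 : ∫⁻ x, ENNReal.ofReal (-f x) ∂Q ≠ ⊤ := hf.neg.lintegral_lt_top.ne
  refine ⟨Or.inl h1, ?_⟩
  rw [extIntegral, integral_eq_lintegral_pos_part_sub_lintegral_neg_part hf, EReal.coe_sub,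
    EReal.coe_ennreal_toReal h1, EReal.coe_ennreal_toReal h2]

theorem lt_extIntegral_sub_iff {f : ℝ → ℝ} {Q : Measure ℝ} (hf : Integrable f Q) (c a : ℝ) :
    (a : EReal) < extIntegral f Q - (c : EReal) ↔ c + a < ∫ x, f x ∂Q := by
  rw [(extIntegral_eq_integral hf).2, ← EReal.coe_sub, EReal.coe_lt_coe_iff, lt_sub_iff_add_lt,
    add_comm]

theorem extIntegral_sub_lt_iff {f : ℝ → ℝ} {Q : Measure ℝ} (hf : Integrable f Q) (c a : ℝ) :
    extIntegral f Q - (c : EReal) < (a : EReal) ↔ ∫ x, f x ∂Q < c + a := by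
  rw [(extIntegral_eq_integral hf).2, ← EReal.coe_sub, EReal.coe_lt_coe_iff, sub_lt_iff_lt_add']

/-- The lower bound makes the negative part finite, so an infinite positive part would force the
value `⊤`. -/
theorem integrable_of_extIntegral_lt_top {f : ℝ → ℝ} {Q : Measure ℝ} [IsFiniteMeasure Q]
    (hf : Measurable f) {b : ℝ} (hb : ∀ᵐ x ∂Q, b ≤ f x) (h : extIntegral f Q < ⊤) :
    Integrable f Q := by
  have hneg : ∫⁻ x, ENNReal.ofReal (-f x) ∂Q ≠ ⊤ := by
    refine ((lintegral_mono_ae (hb.mono fun x hx =>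
      ENNReal.ofReal_le_ofReal (neg_le_neg hx))).trans_lt ?_).ne
    rw [lintegral_const]
    exact ENNReal.mul_lt_top ENNReal.ofReal_lt_top (measure_lt_top Q _)
  have hpos : ∫⁻ x, ENNReal.ofReal (f x) ∂Q ≠ ⊤ := by
    intro htop
    rw [extIntegral, htop, ← ENNReal.ofReal_toReal hneg] at h
    simp at h
  refine ⟨hf.aestronglyMeasurable, ?_⟩
  rw [hasFiniteIntegral_iff_norm]
  have hle : ∀ x, ENNReal.ofReal ‖f x‖ ≤ ENNReal.ofReal (f x) + ENNReal.ofReal (-f x) := by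
    intro x
    rcases le_total 0 (f x) with h0 | h0
    · rw [Real.norm_of_nonneg h0]
      exact le_self_add
    · rw [Real.norm_of_nonpos h0]
      exact le_add_self
  refine (lintegral_mono hle).trans_lt ?_
  rw [lintegral_add_left hf.ennreal_ofReal]
  exact ENNReal.add_lt_top.2 ⟨hpos.lt_top, hneg.lt_top⟩

theorem ae_sub_le_of_domBound_lt_top {P : Measure ℝ} {F U : ℝ → ℝ} {β : ℝ}
    (h : domBound P F U β < ⊤) : ∃ m : ℝ, ∀ᵐ x ∂P, F x - β * U x ≤ m := by
  obtain ⟨m, hm, -⟩ := EReal.lt_iff_exists_real_btwn.1 h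
  refine ⟨m, ?_⟩
  filter_upwards [ae_le_essSup (μ := P) (f := fun x => ((F x - β * U x : ℝ) : EReal))] with x hx
  exact EReal.coe_le_coe_iff.1 (hx.trans hm.le)

/-- Laws of finite entropy in the screened set integrate both functions. -/
theorem integrable_of_mem_screenedSet {P : Measure ℝ} {F U : ℝ → ℝ}
    (hF : Measurable F) (hU : Measurable U) (hF0 : ∀ x, 0 ≤ F x) {ε u β : ℝ} (hβ : 0 < β)
    (hdom : domBound P F U β < ⊤) {Q : ProbabilityMeasure ℝ} (hQ : Q ∈ screenedSet P F U ε u)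
    (hQP : (Q : Measure ℝ) ≪ P) :
    Integrable F (Q : Measure ℝ) ∧ Integrable U (Q : Measure ℝ) := by
  obtain ⟨m, hm⟩ := ae_sub_le_of_domBound_lt_top hdom
  have hm' : ∀ᵐ x ∂(Q : Measure ℝ), F x - β * U x ≤ m := hQP.ae_le hm
  have hUi : Integrable U (Q : Measure ℝ) := by
    -- From `0 ≤ F ≤ m + β * U` follows `U ≥ -m / β`; the same domination then bounds `F` by an
    -- integrable function.
    refine integrable_of_extIntegral_lt_top hU (b := -m / β) (hm'.mono fun x hx => ?_) ?_
    · rw [div_le_iff₀ hβ]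
      linarith [hF0 x, mul_comm β (U x)]
    · have h := hQ.2.2
      rw [lt_top_iff_ne_top]
      intro htop
      rw [htop, EReal.top_sub_coe] at h
      exact not_top_lt h
  refine ⟨((integrable_const m).add (hUi.const_mul β)).mono' hF.aestronglyMeasurable
    (hm'.mono fun x hx => ?_), hUi⟩
  rw [Real.norm_of_nonneg (hF0 x)]
  simp only [Pi.add_apply]
  linarith

theorem mem_sigmaSet_iff {P : Measure ℝ} {F : ℝ → ℝ} {ε : ℝ} {Q : ProbabilityMeasure ℝ}
    (hF : Integrable F (Q : Measure ℝ)) :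
    Q ∈ sigmaSet P F ε ↔ ∫ x, F x ∂P + ε < ∫ x, F x ∂(Q : Measure ℝ) :=
  (and_iff_right (extIntegral_eq_integral hF).1).trans (lt_extIntegral_sub_iff hF _ _)

theorem mem_screenedSet_iff {P : Measure ℝ} {F U : ℝ → ℝ} {ε u : ℝ} {Q : ProbabilityMeasure ℝ}
    (hF : Integrable F (Q : Measure ℝ)) (hU : Integrable U (Q : Measure ℝ)) :
    Q ∈ screenedSet P F U ε u ↔ ∫ x, F x ∂P + ε < ∫ x, F x ∂(Q : Measure ℝ) ∧
      ∫ x, U x ∂(Q : Measure ℝ) < ∫ x, U x ∂P + u :=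
  and_congr (mem_sigmaSet_iff hF)
    ((and_iff_right (extIntegral_eq_integral hU).1).trans (extIntegral_sub_lt_iff hU _ _))

end ExtendedIntegral

/-! ### Normalized logarithms and the two limits. -/

section Rate

theorem klDiv_eq_ofReal {α : Type*} [MeasurableSpace α] {Q P : Measure α} [IsProbabilityMeasure Q]
    [IsProbabilityMeasure P] (hQP : Q ≪ P) (hllr : Integrable (llr Q P) Q) :
    InformationTheory.klDiv Q P = ENNReal.ofReal (∫ x, llr Q P x ∂Q) := by
  rw [InformationTheory.klDiv_of_ac_of_integrable hQP hllr]
  simp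

theorem coe_klDiv {α : Type*} [MeasurableSpace α] {Q P : Measure α} [IsProbabilityMeasure Q]
    [IsProbabilityMeasure P] (hQP : Q ≪ P) (hllr : Integrable (llr Q P) Q) :
    ((InformationTheory.klDiv Q P : ℝ≥0∞) : EReal) = ((∫ x, llr Q P x ∂Q : ℝ) : EReal) := by
  have h := InformationTheory.integral_llr_add_sub_measure_univ_nonneg hQP hllr
  simp only [probReal_univ, add_sub_cancel_right] at h
  rw [klDiv_eq_ofReal hQP hllr, EReal.coe_ennreal_ofReal, max_eq_left h]

theorem infEntropy_le {A : Set (ProbabilityMeasure ℝ)} {P : Measure ℝ} {Q : ProbabilityMeasure ℝ}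
    (hQ : Q ∈ A) : infEntropy A P ≤ InformationTheory.klDiv (Q : Measure ℝ) P :=
  iInf₂_le Q hQ

theorem exists_klDiv_lt_of_lt_neg_infEntropy {A : Set (ProbabilityMeasure ℝ)} {P : Measure ℝ}
    {a : EReal} (h : a < -(infEntropy A P : EReal)) :
    ∃ Q ∈ A, ((InformationTheory.klDiv (Q : Measure ℝ) P : ℝ≥0∞) : EReal) < -a := by
  by_contra! hcon
  refine h.not_ge (EReal.neg_le.1 ?_)
  have hle : (-a).toENNReal ≤ infEntropy A P := le_iInf₂ fun Q hQ => by
    have := EReal.toENNReal_le_toENNReal (hcon Q hQ)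
    rwa [EReal.toENNReal_coe] at this
  exact ((le_max_right 0 _).trans_eq EReal.coe_toENNReal_eq_max.symm).trans
    (EReal.coe_ennreal_le_coe_ennreal_iff.2 hle)

/-- Exponential lower bounds on a sequence of masses pass to normalized logarithms. -/
theorem eventually_lt_inv_mul_log {p : ℕ → ℝ≥0∞} {k s : ℝ} (hks : s < -k)
    (hp : ∀ r : ℝ, k < r → ∀ᶠ n : ℕ in atTop, ENNReal.ofReal (Real.exp (-(n * r))) ≤ 2 * p n) :
    ∀ᶠ n : ℕ in atTop, (s : EReal) < ((1 / (n : ℝ) : ℝ) : EReal) * ENNReal.log (p n) := by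
  -- The gap between `r` and `-s` absorbs the vanishing term `log 2 / n`.
  obtain ⟨r, hkr, hrs⟩ := exists_between (lt_neg_of_lt_neg hks)
  have hlim : Tendsto (fun n : ℕ => -r - Real.log 2 / (n : ℝ)) atTop (𝓝 (-r - 0)) :=
    tendsto_const_nhds.sub (tendsto_const_div_atTop_nhds_zero_nat _)
  filter_upwards [hp r hkr, hlim.eventually_const_lt (by linarith : s < -r - 0),
    eventually_gt_atTop 0] with n hn hs hn0
  have hn' : (0 : ℝ) < n := by exact_mod_cast hn0
  have hle : ENNReal.ofReal (Real.exp (-(n * r)) / 2) ≤ p n := by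
    rw [ENNReal.ofReal_div_of_pos two_pos]
    refine ENNReal.div_le_of_le_mul' ?_
    simpa using hn
  have hlog := ENNReal.log_monotone hle
  rw [ENNReal.log_ofReal_of_pos (by positivity), Real.log_div (Real.exp_pos _).ne' two_ne_zero,
    Real.log_exp] at hlog
  have hnn : (0 : EReal) ≤ ((1 / (n : ℝ) : ℝ) : EReal) := EReal.coe_nonneg.2 (by positivity)
  refine lt_of_lt_of_le ?_ (mul_le_mul_of_nonneg_left hlog hnn)
  rw [← EReal.coe_mul, EReal.coe_lt_coe_iff]
  calc s < -r - Real.log 2 / n := hs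
    _ = 1 / n * (-(n * r) - Real.log 2) := by field_simp

variable {Ω : Type*} [MeasurableSpace Ω] {Pr : Measure Ω} {P : Measure ℝ}
  {X : ℕ → Ω → ℝ}

theorem measure_partialSum_eq_pi_meanEvent (hX : iIndepFun X Pr)
    (hlaw : ∀ i, HasLaw (X i) P Pr) {F U : ℝ → ℝ} (hF : Measurable F) (hU : Measurable U)
    (a b : ℝ) (n : ℕ) :
    Pr {ω | n * a < partialSum F X n ω ∧ partialSum U X n ω < n * b} =
      Measure.pi (fun _ : Fin n => P) (meanEvent F U a b n) := by
  have hind := hX.precomp (g := fun i : Fin n => (i : ℕ)) Fin.val_injective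
  have h := iIndepFun.hasLaw_pi (μ := fun _ : Fin n => P) (fun i => hlaw i) hind
  have h' := h.measure_eq (p := fun x => x ∈ meanEvent F U a b n)
    (measurableSet_meanEvent hF hU a b n)
  refine Eq.trans ?_ h'
  simp only [meanEvent, partialSum, Set.mem_ofPred_eq, ← Fin.sum_univ_eq_sum_range
    (fun i => F (X i _)), ← Fin.sum_univ_eq_sum_range (fun i => U (X i _))]

theorem inv_mul_log_pi_meanEvent_le [IsProbabilityMeasure P]
    {F U : ℝ → ℝ} (hF : Measurable F) (hU : Measurable U)
    (hFi : Integrable F P) (hUi : Integrable U P) (ε u : ℝ) {n : ℕ} (hn : n ≠ 0) :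
    ((1 / (n : ℝ) : ℝ) : EReal) * ENNReal.log (Measure.pi (fun _ : Fin n => P)
        (meanEvent F U (∫ x, F x ∂P + ε) (∫ x, U x ∂P + u) n)) ≤
      -(infEntropy (screenedSet P F U ε u) P : EReal) := by
  have hn' : (0 : ℝ) < n := by exact_mod_cast hn.bot_lt
  set p := Measure.pi (fun _ : Fin n => P)
    (meanEvent F U (∫ x, F x ∂P + ε) (∫ x, U x ∂P + u) n) with hp
  by_cases hp0 : p = 0
  · rw [hp0, ENNReal.log_zero, EReal.coe_mul_bot_of_pos (by positivity)]
    exact bot_le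
  obtain ⟨Q, hQ, hQP, hllr, hFQ, hUQ, ha, hb, hle⟩ :=
    exists_law_of_pi_meanEvent_ne_zero hn hF hU hFi hUi hp0
  have hmem : (⟨Q, hQ⟩ : ProbabilityMeasure ℝ) ∈ screenedSet P F U ε u :=
    (mem_screenedSet_iff hFQ hUQ).2 ⟨ha, hb⟩
  have hinf := EReal.neg_le_neg_iff.2
    (EReal.coe_ennreal_le_coe_ennreal_iff.2 (infEntropy_le hmem (P := P)))
  refine le_trans ?_ hinf
  rw [ProbabilityMeasure.coe_mk, coe_klDiv hQP hllr,
    ENNReal.log_pos_real hp0 (measure_ne_top _ _), ← EReal.coe_mul, ← EReal.coe_neg,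
    EReal.coe_le_coe_iff, one_div, inv_mul_le_iff₀ hn']
  linarith

theorem infEntropy_sigmaSet_eq_zero [IsProbabilityMeasure P]
    {F : ℝ → ℝ} (hF : Measurable F) (hF0 : ∀ x, 0 ≤ F x)
    (hFi : Integrable F P)
    (h_heavy : ∀ θ : ℝ, 0 < θ → ∫⁻ x, ENNReal.ofReal (Real.exp (θ * F x)) ∂P = ⊤) {ε : ℝ}
    (hε : 0 < ε) : infEntropy (sigmaSet P F ε) P = 0 := by
  have hμ : 0 ≤ ∫ x, F x ∂P := integral_nonneg hF0
  -- Aiming at `2 * ε` keeps the constraint strict; the tilt bound `η / c` then gives entropy at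
  -- most `η`.
  have hc : 0 < ∫ x, F x ∂P + 2 * ε := by linarith
  refine le_antisymm (ENNReal.le_of_forall_pos_le_add fun η hη _ => ?_) zero_le
  obtain ⟨Q, hQ, hQP, hllr, hFQ, hcF, hle⟩ := exists_law_integral_ge_of_heavy_tailed hF hF0 hFi
    h_heavy (c := ∫ x, F x ∂P + 2 * ε) (by linarith)
    (div_pos (NNReal.coe_pos.2 hη) hc)
  rw [div_mul_cancel₀ _ hc.ne'] at hle
  have hmem : (⟨Q, hQ⟩ : ProbabilityMeasure ℝ) ∈ sigmaSet P F ε :=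
    (mem_sigmaSet_iff hFQ).2 (by simp only [ProbabilityMeasure.coe_mk]; linarith)
  refine (infEntropy_le hmem).trans ?_
  rw [ProbabilityMeasure.coe_mk, klDiv_eq_ofReal hQP hllr, zero_add]
  exact ENNReal.ofReal_le_of_le_toReal hle

theorem infEntropy_screenedSet_pos [IsProbabilityMeasure P]
    {F U : ℝ → ℝ} (hF : Measurable F) (hU : Measurable U)
    (hF0 : ∀ x, 0 ≤ F x) (hFi : Integrable F P) (hUi : Integrable U P)
    (hF2 : Integrable (fun x => F x ^ 2) P) (hU2 : Integrable (fun x => U x ^ 2) P)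
    (h_dom : ∀ β : ℝ, 0 < β → domBound P F U β < ⊤) {ε u : ℝ} (hε : 0 < ε) (hu : 0 < u) :
    0 < infEntropy (screenedSet P F U ε u) P := by
  -- With this choice, `F - β * U` gains more than `ε - β * u = ε / 2` in mean.
  set β := ε / (2 * u)
  have hβ : 0 < β := by positivity
  have hβu : β * u = ε / 2 := by simp only [β]; field_simp
  obtain ⟨m, hm⟩ := ae_sub_le_of_domBound_lt_top (h_dom β hβ)
  have hWi : Integrable (fun x => F x - β * U x) P := hFi.sub (hUi.const_mul β)
  have hL2 : MemLp (fun x => F x - β * U x) 2 P :=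
    ((memLp_two_iff_integrable_sq hF.aestronglyMeasurable).2 hF2).sub
      (((memLp_two_iff_integrable_sq hU.aestronglyMeasurable).2 hU2).const_mul β)
  obtain ⟨κ, hκ, hκQ⟩ := exists_pos_le_integral_llr (hF.sub (hU.const_mul β)) hWi
    hL2.integrable_sq hm (half_pos hε)
  refine (ENNReal.ofReal_pos.2 hκ).trans_le (le_iInf₂ fun Q hQ => ?_)
  by_cases htop : InformationTheory.klDiv (Q : Measure ℝ) P = ⊤
  · rw [htop]
    exact le_top
  obtain ⟨hQP, hllr⟩ := InformationTheory.klDiv_ne_top_iff.1 htop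
  obtain ⟨hFQ, hUQ⟩ := integrable_of_mem_screenedSet hF hU hF0 hβ (h_dom β hβ) hQ hQP
  obtain ⟨h1, h2⟩ := (mem_screenedSet_iff hFQ hUQ).1 hQ
  rw [klDiv_eq_ofReal hQP hllr]
  refine ENNReal.ofReal_le_ofReal (hκQ Q inferInstance hQP hllr (hFQ.sub (hUQ.const_mul β)) ?_)
  simp only [Pi.sub_apply]
  rw [integral_sub hFi (hUi.const_mul β), integral_sub hFQ (hUQ.const_mul β), integral_const_mul,
    integral_const_mul]
  nlinarith [mul_lt_mul_of_pos_left h2 hβ]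

theorem tendsto_log_measure_sum_gt [IsProbabilityMeasure P] [IsProbabilityMeasure Pr]
    (hX : iIndepFun X Pr)
    (hlaw : ∀ i, HasLaw (X i) P Pr) {F : ℝ → ℝ} (hF : Measurable F) (hF0 : ∀ x, 0 ≤ F x)
    (hFi : Integrable F P)
    (h_heavy : ∀ θ : ℝ, 0 < θ → ∫⁻ x, ENNReal.ofReal (Real.exp (θ * F x)) ∂P = ⊤) (ε : ℝ) :
    Tendsto (fun n : ℕ => ((1 / (n : ℝ) : ℝ) : EReal) * ENNReal.log
      (Pr {ω | partialSum F X n ω - n * (∫ x, F x ∂P) > n * ε})) atTop (𝓝 0) := by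
  refine tendsto_order.2 ⟨fun a ha => ?_, fun a ha => Eventually.of_forall fun n => ?_⟩
  · obtain ⟨s, has, hs⟩ := EReal.lt_iff_exists_real_btwn.1 ha
    replace hs : s < 0 := EReal.coe_lt_coe_iff.1 hs
    have hμ : 0 ≤ ∫ x, F x ∂P := integral_nonneg hF0
    -- As `ε` may have any sign here, `|ε| + 1` puts `c` above both the mean of `F` and that mean
    -- plus `ε`.
    set c := ∫ x, F x ∂P + |ε| + 1
    have hc : 0 < c := by positivity
    obtain ⟨Q, hQ, hQP, hllr, hFQ, hcF, hle⟩ := exists_law_integral_ge_of_heavy_tailed hF hF0 hFi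
      h_heavy (c := c) (by simp only [c]; linarith [abs_nonneg ε])
      (div_pos (half_pos (neg_pos.2 hs)) hc)
    rw [div_mul_cancel₀ _ hc.ne'] at hle
    refine (eventually_lt_inv_mul_log (k := ∫ x, llr Q P x ∂Q) (by linarith)
      fun r hr => ?_).mono fun n hn => has.trans hn
    -- Taking `U = 0` and `b = 1` makes the second constraint harmless; only one inclusion of events
    -- is needed afterwards.
    have h := eventually_exp_le_two_mul_pi hQP hllr hF (measurable_const (a := (0 : ℝ))) hFQ
      (integrable_const 0) (a := ∫ x, F x ∂P + ε) (b := 1)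
      (by simp only [c] at hcF; linarith [le_abs_self ε]) (by simp) hr
    filter_upwards [h] with n hn
    rw [← measure_partialSum_eq_pi_meanEvent hX hlaw hF measurable_const] at hn
    refine hn.trans (mul_le_mul_right (measure_mono fun ω hω => ?_) 2)
    have h1 := hω.1
    simp only [Set.mem_ofPred_eq, gt_iff_lt]
    linarith
  · refine lt_of_le_of_lt ?_ ha
    have h1 : ENNReal.log (Pr {ω | partialSum F X n ω - n * (∫ x, F x ∂P) > n * ε}) ≤ 0 :=
      ENNReal.log_le_zero_iff.2 prob_le_one
    exact mul_nonpos_of_nonneg_of_nonpos (EReal.coe_nonneg.2 (by positivity)) h1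

/-- Domination at a single `β` suffices: it serves only to make the laws of finite entropy in `E`
integrate `F` and `U`. -/
theorem tendsto_log_measure_screened [IsProbabilityMeasure P]
    (hX : iIndepFun X Pr)
    (hlaw : ∀ i, HasLaw (X i) P Pr) {F U : ℝ → ℝ} (hF : Measurable F) (hU : Measurable U)
    (hF0 : ∀ x, 0 ≤ F x) (hFi : Integrable F P) (hUi : Integrable U P) {β : ℝ} (hβ : 0 < β)
    (hdom : domBound P F U β < ⊤) (ε u : ℝ) :
    Tendsto (fun n : ℕ => ((1 / (n : ℝ) : ℝ) : EReal) * ENNReal.log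
      (Pr {ω | partialSum F X n ω - n * (∫ x, F x ∂P) > n * ε ∧
        partialSum U X n ω - n * (∫ x, U x ∂P) < n * u})) atTop
      (𝓝 (-(infEntropy (screenedSet P F U ε u) P : EReal))) := by
  have hset : ∀ n : ℕ, Pr {ω | partialSum F X n ω - n * (∫ x, F x ∂P) > n * ε ∧
      partialSum U X n ω - n * (∫ x, U x ∂P) < n * u} = Measure.pi (fun _ : Fin n => P)
        (meanEvent F U (∫ x, F x ∂P + ε) (∫ x, U x ∂P + u) n) := fun n => by
    rw [← measure_partialSum_eq_pi_meanEvent hX hlaw hF hU]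
    congr 1
    ext ω
    simp only [Set.mem_ofPred_eq, gt_iff_lt, mul_add, lt_sub_iff_add_lt', sub_lt_iff_lt_add']
  simp_rw [hset]
  refine tendsto_order.2 ⟨fun a ha => ?_, fun a ha => ?_⟩
  · obtain ⟨Q, hQ, hlt⟩ := exists_klDiv_lt_of_lt_neg_infEntropy ha
    have htop : InformationTheory.klDiv (Q : Measure ℝ) P ≠ ⊤ := by
      intro h
      rw [h] at hlt
      exact not_top_lt hlt
    obtain ⟨hQP, hllr⟩ := InformationTheory.klDiv_ne_top_iff.1 htop
    obtain ⟨hFQ, hUQ⟩ := integrable_of_mem_screenedSet hF hU hF0 hβ hdom hQ hQP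
    obtain ⟨h1, h2⟩ := (mem_screenedSet_iff hFQ hUQ).1 hQ
    rw [coe_klDiv hQP hllr] at hlt
    obtain ⟨s, has, hs⟩ := EReal.lt_iff_exists_real_btwn.1 (EReal.lt_neg_comm.1 hlt)
    rw [← EReal.coe_neg, EReal.coe_lt_coe_iff] at hs
    exact (eventually_lt_inv_mul_log hs fun r hr =>
      eventually_exp_le_two_mul_pi hQP hllr hF hU hFQ hUQ h1 h2 hr).mono fun n hn => has.trans hn
  · filter_upwards [eventually_ne_atTop 0] with n hn
    exact (inv_mul_log_pi_meanEvent_le hF hU hFi hUi ε u hn).trans_lt ha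

end Rate

end ScreenedEstimation

theorem theorem2p1 {Ω : Type*} [MeasurableSpace Ω] (Pr : Measure Ω) [IsProbabilityMeasure Pr]
    (P : Measure ℝ) [IsProbabilityMeasure P]
    (X : ℕ → Ω → ℝ) (hX_indep : iIndepFun X Pr) (hX_law : ∀ i, HasLaw (X i) P Pr)
    (F U : ℝ → ℝ) (hF_meas : Measurable F) (hU_meas : Measurable U)
    (hF_nonneg : ∀ x, 0 ≤ F x)
    (hF_int : Integrable F P) (hU_int : Integrable U P)
    (hF_sq : Integrable (fun x => F x ^ 2) P) (hU_sq : Integrable (fun x => U x ^ 2) P)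
    (h_heavy : ∀ θ : ℝ, 0 < θ → ∫⁻ x, ENNReal.ofReal (Real.exp (θ * F x)) ∂P = ⊤)
    (h_dom : ∀ β : ℝ, 0 < β → ScreenedEstimation.domBound P F U β < ⊤) :
    (∀ ε : ℝ, 0 < ε →
      Tendsto (fun n : ℕ => ((1 / (n : ℝ) : ℝ) : EReal) * ENNReal.log
          (Pr {ω | ScreenedEstimation.partialSum F X n ω - n * (∫ x, F x ∂P) > n * ε}))
        atTop
        (𝓝 (-(ScreenedEstimation.infEntropy (ScreenedEstimation.sigmaSet P F ε) P : EReal))) ∧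
      -(ScreenedEstimation.infEntropy (ScreenedEstimation.sigmaSet P F ε) P : EReal) = 0) ∧
    (∀ ε u : ℝ, 0 < ε → 0 < u →
      Tendsto (fun n : ℕ => ((1 / (n : ℝ) : ℝ) : EReal) * ENNReal.log
          (Pr {ω | ScreenedEstimation.partialSum F X n ω - n * (∫ x, F x ∂P) > n * ε ∧
            ScreenedEstimation.partialSum U X n ω - n * (∫ x, U x ∂P) < n * u}))
        atTop
        (𝓝 (-(ScreenedEstimation.infEntropy
          (ScreenedEstimation.screenedSet P F U ε u) P : EReal))) ∧
      -(ScreenedEstimation.infEntropy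
          (ScreenedEstimation.screenedSet P F U ε u) P : EReal) < 0) := by
  refine ⟨fun ε hε => ?_, fun ε u hε hu => ⟨?_, ?_⟩⟩
  · rw [ScreenedEstimation.infEntropy_sigmaSet_eq_zero hF_meas hF_nonneg hF_int h_heavy hε]
    simp only [EReal.coe_ennreal_zero, neg_zero, and_true]
    exact ScreenedEstimation.tendsto_log_measure_sum_gt hX_indep hX_law hF_meas hF_nonneg hF_int
      h_heavy ε
  · exact ScreenedEstimation.tendsto_log_measure_screened hX_indep hX_law hF_meas hU_meas hF_nonneg
      hF_int hU_int one_pos (h_dom 1 one_pos) ε u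
  · rw [EReal.neg_lt_zero, EReal.coe_ennreal_pos]
    exact ScreenedEstimation.infEntropy_screenedSet_pos hF_meas hU_meas hF_nonneg hF_int hU_int
      hF_sq hU_sq h_dom hε hu
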